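/- For $a\in(-1,1)$ let $\sigma_a:\mathbb{R}\to\mathbb{R}$ be given by $\sigma_a(x)=x$ if $x\ge 0$ and $\sigma_a(x)=ax$ if $x<0$. A fully connected network of depth $L\ge 1$ with widths $n_0=d_{in},n_1,\dots,n_{L-1},n_L=d_{out}$ and parameters $\mathbf{W}=(W_1,b_1,\dots,W_L,b_L)$, where $W_\ell\in\mathbb{R}^{n_\ell\times n_{\ell-1}}$ and $b_\ell\in\mathbb{R}^{n_\ell}$, computes the function $f_{\mathbf{W}}:\mathbb{R}^{d_{in}}\to\mathbb{R}^{d_{out}}$, $f_{\mathbf{W}}(x)=W_L\alpha_{L-1}(x)+b_L$, where $\alpha_0(x)=x$ and $\alpha_\ell(x)=\sigma_a\big(W_\ell\alpha_{\ell-1}(x)+b_\ell\big)$ for $1\le\ell\le L-1$, with $\sigma_a$ applied entrywise. A function $f:\mathbb{R}^{d_{in}}\to\mathbb{R}^{d_{out}}$ is called (finite) piecewise linear if $\mathbb{R}^{d_{in}}$ is the union of finitely many polyhedra (solution sets of finite systems of non-strict affine inequalities) on each of which $f$ agrees with an affine map; such a function is automatically continuous. **Corollary.** Let $a\in(-1,1)$.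 For any depth $L\ge\lceil\log_2(d_{in}+1)\rceil+1$ and any piecewise linear function $f:\mathbb{R}^{d_{in}}\to\mathbb{R}^{d_{out}}$, there are (positive) hidden widths $n_1,\dots,n_{L-1}$ and parameters $\mathbf{W}$ of a depth-$L$ network with nonlinearity $\sigma_a$ such that $f_{\mathbf{W}}=f$ on all of $\mathbb{R}^{d_{in}}$. -/

import Mathlib

open scoped Matrix

/-- The nonlinearity `σ_a`: the identity on `[0, ∞)` and multiplication by `a` on `(-∞, 0)`. -/
noncomputable def sigmaA (a x : ℝ) : ℝ :=
  if 0 ≤ x then x else a * x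

/-- The weights and biases `(W₁, b₁, …, W_L, b_L)` of a fully connected network with input
dimension `d`, list of hidden widths `[n₁, …, n_{L-1}]` and output dimension `e`.
The depth `L` (number of affine layers) is the length of the list of hidden widths plus one. -/
inductive NetParams : ℕ → List ℕ → ℕ → Type
  /-- No hidden layer: the only layer is the (affine) output layer. -/
  | output {d e : ℕ} (W : Matrix (Fin e) (Fin d) ℝ) (b : Fin e → ℝ) : NetParams d [] e
  /-- A first hidden layer with `m` neurons, followed by the remaining layers. -/
  | hidden {d m e : ℕ} {ns : List ℕ} (W : Matrix (Fin m) (Fin d) ℝ) (b : Fin m → ℝ)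
      (rest : NetParams m ns e) : NetParams d (m :: ns) e

/-- The network function: every layer applies `x ↦ W x + b`, the nonlinearity `σ` is applied
entrywise after every layer except the last one (the output is the last pre-activation). -/
def NetParams.toFun (σ : ℝ → ℝ) {d e : ℕ} {ns : List ℕ} :
    NetParams d ns e → (Fin d → ℝ) → (Fin e → ℝ)
  | .output W b, x => W *ᵥ x + b
  | .hidden W b rest, x => rest.toFun σ (fun i => σ ((W *ᵥ x + b) i))

/-- A (closed, convex, possibly unbounded) polyhedron in `ℝ^d`: the solution set of a finite
system of non-strict affine inequalities. -/
def IsPolyhedron {d : ℕ} (P : Set (Fin d → ℝ)) : Prop :=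
  ∃ (m : ℕ) (A : Matrix (Fin m) (Fin d) ℝ) (c : Fin m → ℝ), P = {x | ∀ i, (A *ᵥ x) i ≤ c i}

/-- Piecewise linear functions with finitely many linear regions: `ℝ^d` is the union of finitely
many polyhedra, on each of which `f` agrees with an affine map. Such functions are automatically
continuous, since the polyhedra are closed. -/
def IsPiecewiseLinear {d e : ℕ} (f : (Fin d → ℝ) → (Fin e → ℝ)) : Prop :=
  ∃ S : Set (Set (Fin d → ℝ)), S.Finite ∧ (∀ P ∈ S, IsPolyhedron P) ∧ ⋃₀ S = Set.univ ∧
    ∀ P ∈ S, ∃ (A : Matrix (Fin e) (Fin d) ℝ) (b : Fin e → ℝ), ∀ x ∈ P, f x = A *ᵥ x + b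

/-! A max-min formula over the affine pieces writes each component of `f` as a difference of maxima
of affine functions (`mem_diffMaxAffine_of_continuous_selection`). An affine dependence turns a
maximum of more than `d + 1` affine functions into a linear combination of maxima of fewer, so at
most `d + 1` at a time suffice (`sup'_mem_span_affineMaxima`). Such maxima are computed by a binary
tree of pairwise maxima: as `a ≠ ±1`, both the identity and `max x 0` are combinations of `sigmaA a
x` and `sigmaA a (-x)`, so one layer per level is enough. Linear combinations cost no depth, being
absorbed by the next affine layer. -/

/-- The affine functions `ℝ^d → ℝ`. -/
def affineFunctions (d : ℕ) : Submodule ℝ ((Fin d → ℝ) → ℝ) where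
  carrier := {f | ∃ (w : Fin d → ℝ) (b : ℝ), ∀ x, f x = w ⬝ᵥ x + b}
  add_mem' := by
    rintro f g ⟨w, b, hf⟩ ⟨v, c, hg⟩
    refine ⟨w + v, b + c, fun x => ?_⟩
    rw [Pi.add_apply, hf, hg, add_dotProduct]
    ring
  zero_mem' := ⟨0, 0, fun x => by simp⟩
  smul_mem' := by
    rintro r f ⟨w, b, hf⟩
    refine ⟨r • w, r * b, fun x => ?_⟩
    rw [Pi.smul_apply, hf, smul_dotProduct, smul_eq_mul, smul_eq_mul]
    ring

theorem mem_affineFunctions {d : ℕ} {f : (Fin d → ℝ) → ℝ} :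
    f ∈ affineFunctions d ↔ ∃ (w : Fin d → ℝ) (b : ℝ), ∀ x, f x = w ⬝ᵥ x + b :=
  Iff.rfl

/-! ### Maxima of affine functions -/

/-- The maxima of nonempty finite sets of at most `n` affine functions. -/
def affineMaxima (d n : ℕ) : Set ((Fin d → ℝ) → ℝ) :=
  {g | ∃ (s : Finset ((Fin d → ℝ) → ℝ)) (hs : s.Nonempty),
    (∀ f ∈ s, f ∈ affineFunctions d) ∧ s.card ≤ n ∧ g = s.sup' hs id}

open scoped Classical in
/-- Among at least `d + 2` affine functions on `ℝ^d` one finds two disjoint nonempty families such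
that everywhere some member of the second is dominated by some member of the first. -/
theorem exists_dominating_partition {d : ℕ} {s : Finset ((Fin d → ℝ) → ℝ)}
    (hs : ∀ f ∈ s, f ∈ affineFunctions d) (hcard : d + 1 < s.card) :
    ∃ P N : Finset ((Fin d → ℝ) → ℝ), P.Nonempty ∧ Disjoint P N ∧ s = P ∪ N ∧
      ∀ x, ∃ j ∈ N, ∃ i ∈ P, j x ≤ i x := by
  choose w b hwb using fun f : s => mem_affineFunctions.1 (hs f f.2)
  -- The extra coordinate `1` forces the coefficients to sum to zero; then `∑ c f * f x` does not
  -- depend on `x`.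
  have hdep : ¬ LinearIndependent ℝ (fun f : s => (w f, (1 : ℝ))) := by
    intro h
    have := h.fintype_card_le_finrank
    simp at this
    omega
  obtain ⟨c, hc, hne⟩ : ∃ c : s → ℝ, ∑ f, c f • (w f, (1 : ℝ)) = 0 ∧ ∃ f, c f ≠ 0 :=
    Fintype.not_linearIndependent_iff.1 hdep
  obtain ⟨c, hc, hne, hb⟩ : ∃ c : s → ℝ, ∑ f, c f • (w f, (1 : ℝ)) = 0 ∧ (∃ f, c f ≠ 0) ∧
      0 ≤ ∑ f, c f * b f := by
    rcases le_total 0 (∑ f, c f * b f) with h | h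
    · exact ⟨c, hc, hne, h⟩
    · refine ⟨-c, ?_, ?_, ?_⟩
      · simp only [Pi.neg_apply, neg_smul, Finset.sum_neg_distrib, hc, neg_zero]
      · simpa using hne
      · simpa [Finset.sum_neg_distrib] using h
  have hc1 : ∑ f, c f = 0 := by
    have := congrArg Prod.snd hc
    simpa [Prod.snd_sum] using this
  have hcw : ∑ f, c f • w f = 0 := by
    have := congrArg Prod.fst hc
    simpa [Prod.fst_sum] using this
  have hsum : ∀ x, ∑ f, c f * f.1 x = ∑ f, c f * b f := by
    intro x
    have : (∑ f, c f • w f) ⬝ᵥ x = 0 := by rw [hcw, zero_dotProduct]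
    rw [sum_dotProduct] at this
    simp only [hwb, mul_add, Finset.sum_add_distrib]
    simp only [smul_dotProduct, smul_eq_mul] at this
    rw [this, zero_add]
  obtain ⟨p, -, hp⟩ := Finset.exists_pos_of_sum_zero_of_exists_nonzero c hc1
    (by obtain ⟨f, hf⟩ := hne; exact ⟨f, Finset.mem_univ _, hf⟩)
  obtain ⟨n, -, hn⟩ := Finset.exists_pos_of_sum_zero_of_exists_nonzero (s := Finset.univ) (-c)
    (by simpa [Finset.sum_neg_distrib] using hc1)
    (by obtain ⟨f, hf⟩ := hne; exact ⟨f, Finset.mem_univ _, by simpa using hf⟩)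
  have hn' : c n < 0 := by simpa using hn
  have hP : (Finset.univ.filter fun f => 0 < c f).Nonempty := ⟨p, by simpa using hp⟩
  refine ⟨(Finset.univ.filter fun f => 0 < c f).image Subtype.val,
    (Finset.univ.filter fun f => ¬ 0 < c f).image Subtype.val, hP.image _, ?_, ?_, ?_⟩
  · rw [Finset.disjoint_image Subtype.val_injective]
    exact Finset.disjoint_filter_filter_not _ _ _
  · rw [← Finset.image_union, Finset.filter_union_filter_not_eq]
    ext f
    simp
  · intro x
    by_contra! hcon
    obtain ⟨m, hm, hmax⟩ := Finset.exists_max_image _ (fun f : s => f.1 x) hP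
    -- If `N` lay strictly above `P` at `x`, this sum would be negative, strictly because of `n`;
    -- but it equals the constant `∑ c f * b f`, made nonnegative by the choice of sign of `c`.
    have key : ∑ f, c f * (f.1 x - m.1 x) < 0 := by
      have hlt : ∀ f, ¬ 0 < c f → m.1 x < f.1 x := fun f hf =>
        hcon f.1 (Finset.mem_image_of_mem _ (by simpa using hf)) m.1 (Finset.mem_image_of_mem _ hm)
      refine Finset.sum_neg' (fun f _ => ?_) ⟨n, Finset.mem_univ _, ?_⟩
      · by_cases hf : 0 < c f
        · exact mul_nonpos_of_nonneg_of_nonpos hf.le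
            (sub_nonpos.2 (hmax f (by simpa using hf)))
        · exact mul_nonpos_of_nonpos_of_nonneg (not_lt.1 hf) (sub_nonneg.2 (hlt f hf).le)
      · exact mul_neg_of_neg_of_pos hn' (sub_pos.2 (hlt n hn'.le.not_gt))
    simp only [mul_sub, Finset.sum_sub_distrib, hsum, ← Finset.sum_mul, hc1, zero_mul,
      sub_zero] at key
    linarith

/-- If everywhere some member of `N` is dominated by some member of `P`, the alternating sum over
`T ⊆ N` of the maxima of `P ∪ T` vanishes. -/
theorem sum_powerset_neg_one_pow_smul_sup'_eq_zero {X : Type*} [DecidableEq (X → ℝ)]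
    {P N : Finset (X → ℝ)} (hP : P.Nonempty) (h : ∀ x, ∃ j ∈ N, ∃ i ∈ P, j x ≤ i x) :
    ∑ T ∈ N.powerset, (-1 : ℝ) ^ T.card •
      (P ∪ T).sup' (hP.mono Finset.subset_union_left) id = 0 := by
  ext x
  obtain ⟨j, hj, i, hi, hji⟩ := h x
  -- Pair `T` with `insert j T`: at `x` the dominated `j` does not change the maximum, and the signs
  -- are opposite.
  rw [← Finset.insert_erase hj, Finset.sum_powerset_insert (Finset.notMem_erase j N),
    Pi.add_apply, Finset.sum_apply, Finset.sum_apply, ← Finset.sum_add_distrib]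
  refine Finset.sum_eq_zero fun T hT => ?_
  have hjT : j ∉ T := fun hjT => Finset.notMem_erase j N (Finset.mem_powerset.1 hT hjT)
  have hsup : (P ∪ insert j T).sup' (hP.mono Finset.subset_union_left) id x =
      (P ∪ T).sup' (hP.mono Finset.subset_union_left) id x := by
    rw [Finset.sup'_apply, Finset.sup'_apply]
    apply le_antisymm
    · refine Finset.sup'_le _ _ fun f hf => ?_
      rw [Finset.union_insert, Finset.mem_insert] at hf
      rcases hf with rfl | hf
      · exact hji.trans (Finset.le_sup' (fun f : X → ℝ => f x) (Finset.mem_union_left _ hi))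
      · exact Finset.le_sup' (fun f : X → ℝ => id f x) hf
    · exact Finset.sup'_mono _
        (Finset.union_subset_union_right (Finset.subset_insert _ _)) _
  rw [Pi.smul_apply, Pi.smul_apply, hsup, Finset.card_insert_of_notMem hjT, pow_succ]
  simp

/-- Every maximum of finitely many affine functions on `ℝ^d` is a linear combination of maxima of
at most `d + 1` affine functions. -/
theorem sup'_mem_span_affineMaxima {d : ℕ} (s : Finset ((Fin d → ℝ) → ℝ)) (hne : s.Nonempty)
    (hs : ∀ f ∈ s, f ∈ affineFunctions d) :
    s.sup' hne id ∈ Submodule.span ℝ (affineMaxima d (d + 1)) := by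
  classical
  induction s using Finset.strongInduction with
  | H s ih =>
    by_cases hcard : s.card ≤ d + 1
    · exact Submodule.subset_span ⟨s, hne, hs, hcard, rfl⟩
    · obtain ⟨P, N, hP, hdisj, rfl, hdom⟩ := exists_dominating_partition hs (not_le.1 hcard)
      have hzero := sum_powerset_neg_one_pow_smul_sup'_eq_zero hP hdom
      -- The term `T = N` is the given maximum up to sign; all others are maxima over proper
      -- subsets.
      rw [← Finset.sum_erase_add _ _ (Finset.mem_powerset_self N)] at hzero
      have hrest : ∑ T ∈ N.powerset.erase N, (-1 : ℝ) ^ T.card •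
          (P ∪ T).sup' (hP.mono Finset.subset_union_left) id ∈
            Submodule.span ℝ (affineMaxima d (d + 1)) := by
        refine Submodule.sum_mem _ fun T hT => Submodule.smul_mem _ _ ?_
        rw [Finset.mem_erase, Finset.mem_powerset] at hT
        have hsub : P ∪ T ⊆ P ∪ N := Finset.union_subset_union_right hT.2
        refine ih _ (hsub.ssubset_of_ne fun heq => hT.1 ?_) _ fun f hf => hs f (hsub hf)
        refine hT.2.antisymm fun f hf => ?_
        have : f ∈ P ∪ T := heq ▸ Finset.mem_union_right P hf
        exact (Finset.mem_union.1 this).resolve_left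
          fun hfP => Finset.disjoint_left.1 hdisj hfP hf
      have hlast := (Submodule.neg_mem _ hrest)
      rw [← eq_neg_of_add_eq_zero_right hzero] at hlast
      exact (Submodule.smul_mem_iff _ (pow_ne_zero N.card (neg_ne_zero.2 one_ne_zero))).1 hlast

/-! ### Differences of maxima of affine functions -/

/-- The maxima of nonempty finite sets of affine functions. -/
def maxAffine (d : ℕ) : Set ((Fin d → ℝ) → ℝ) :=
  {g | ∃ (s : Finset ((Fin d → ℝ) → ℝ)) (hs : s.Nonempty),
    (∀ f ∈ s, f ∈ affineFunctions d) ∧ g = s.sup' hs id}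

theorem mem_maxAffine_of_mem_affineFunctions {d : ℕ} {f : (Fin d → ℝ) → ℝ}
    (hf : f ∈ affineFunctions d) : f ∈ maxAffine d :=
  ⟨{f}, Finset.singleton_nonempty f, by simpa using hf, by simp⟩

theorem sup_mem_maxAffine {d : ℕ} {f g : (Fin d → ℝ) → ℝ} (hf : f ∈ maxAffine d)
    (hg : g ∈ maxAffine d) : f ⊔ g ∈ maxAffine d := by
  classical
  obtain ⟨s, hs, hsa, rfl⟩ := hf
  obtain ⟨t, ht, hta, rfl⟩ := hg
  refine ⟨s ∪ t, hs.mono Finset.subset_union_left, fun f hf => ?_, (Finset.sup'_union hs ht id).symm⟩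
  exact (Finset.mem_union.1 hf).elim (hsa f) (hta f)

theorem add_mem_maxAffine {d : ℕ} {f g : (Fin d → ℝ) → ℝ} (hf : f ∈ maxAffine d)
    (hg : g ∈ maxAffine d) : f + g ∈ maxAffine d := by
  classical
  obtain ⟨s, hs, hsa, rfl⟩ := hf
  obtain ⟨t, ht, hta, rfl⟩ := hg
  refine ⟨Finset.image₂ (· + ·) s t, hs.image₂ ht, fun f hf => ?_, ?_⟩
  · obtain ⟨u, hu, v, hv, rfl⟩ := Finset.mem_image₂.1 hf
    exact add_mem (hsa u hu) (hta v hv)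
  · ext x
    rw [Pi.add_apply, Finset.sup'_apply, Finset.sup'_apply, Finset.sup'_apply]
    apply le_antisymm
    · obtain ⟨u, hu, hu'⟩ := Finset.exists_mem_eq_sup' hs (fun f : (Fin d → ℝ) → ℝ => id f x)
      obtain ⟨v, hv, hv'⟩ := Finset.exists_mem_eq_sup' ht (fun f : (Fin d → ℝ) → ℝ => id f x)
      rw [hu', hv']
      exact Finset.le_sup' (fun f : (Fin d → ℝ) → ℝ => id f x) 
        (Finset.mem_image₂_of_mem (f := (· + ·)) hu hv)
    · refine Finset.sup'_le _ _ fun f hf => ?_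
      obtain ⟨u, hu, v, hv, rfl⟩ := Finset.mem_image₂.1 hf
      exact add_le_add (Finset.le_sup' (fun f : (Fin d → ℝ) → ℝ => id f x) hu)
        (Finset.le_sup' (fun f : (Fin d → ℝ) → ℝ => id f x) hv)

/-- The differences of two maxima of affine functions. -/
def diffMaxAffine (d : ℕ) : Set ((Fin d → ℝ) → ℝ) :=
  {f | ∃ g ∈ maxAffine d, ∃ h ∈ maxAffine d, f = g - h}

theorem mem_diffMaxAffine_of_mem_affineFunctions {d : ℕ} {f : (Fin d → ℝ) → ℝ}
    (hf : f ∈ affineFunctions d) : f ∈ diffMaxAffine d :=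
  ⟨f, mem_maxAffine_of_mem_affineFunctions hf, 0,
    mem_maxAffine_of_mem_affineFunctions (zero_mem _), (sub_zero f).symm⟩

theorem neg_mem_diffMaxAffine {d : ℕ} {f : (Fin d → ℝ) → ℝ} (hf : f ∈ diffMaxAffine d) :
    -f ∈ diffMaxAffine d := by
  obtain ⟨g, hg, h, hh, rfl⟩ := hf
  exact ⟨h, hh, g, hg, neg_sub g h⟩

theorem sup_mem_diffMaxAffine {d : ℕ} {f₁ f₂ : (Fin d → ℝ) → ℝ} (h₁ : f₁ ∈ diffMaxAffine d)
    (h₂ : f₂ ∈ diffMaxAffine d) : f₁ ⊔ f₂ ∈ diffMaxAffine d := by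
  obtain ⟨g₁, hg₁, k₁, hk₁, rfl⟩ := h₁
  obtain ⟨g₂, hg₂, k₂, hk₂, rfl⟩ := h₂
  refine ⟨(g₁ + k₂) ⊔ (g₂ + k₁), sup_mem_maxAffine (add_mem_maxAffine hg₁ hk₂)
    (add_mem_maxAffine hg₂ hk₁), k₁ + k₂, add_mem_maxAffine hk₁ hk₂, ?_⟩
  ext x
  simp only [Pi.sup_apply, Pi.sub_apply, Pi.add_apply]
  rw [← max_sub_sub_right]
  congr 1 <;> ring

theorem inf_mem_diffMaxAffine {d : ℕ} {f₁ f₂ : (Fin d → ℝ) → ℝ} (h₁ : f₁ ∈ diffMaxAffine d)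
    (h₂ : f₂ ∈ diffMaxAffine d) : f₁ ⊓ f₂ ∈ diffMaxAffine d := by
  have := neg_mem_diffMaxAffine
    (sup_mem_diffMaxAffine (neg_mem_diffMaxAffine h₁) (neg_mem_diffMaxAffine h₂))
  rwa [neg_sup, neg_neg, neg_neg] at this

theorem mem_span_affineMaxima_of_mem_diffMaxAffine {d : ℕ} {f : (Fin d → ℝ) → ℝ}
    (hf : f ∈ diffMaxAffine d) : f ∈ Submodule.span ℝ (affineMaxima d (d + 1)) := by
  obtain ⟨g, ⟨s, hs, hsa, rfl⟩, h, ⟨t, ht, hta, rfl⟩, rfl⟩ := hf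
  exact sub_mem (sup'_mem_span_affineMaxima s hs hsa) (sup'_mem_span_affineMaxima t ht hta)

/-! ### Max-min representation of continuous selections of affine functions -/

/-- If a continuous function `g` on `[0, 1]` agrees at each point with one of finitely many affine
functions, then one of these affine functions is above `g` at `0` and below `g` at `1`. -/
theorem exists_affine_ge_at_zero_le_at_one {ι : Type*} [Finite ι] {g : ℝ → ℝ}
    (hg : Continuous g) (p q : ι → ℝ) (hsel : ∀ t, ∃ i, g t = p i * t + q i) :
    ∃ i, g 0 ≤ q i ∧ p i + q i ≤ g 1 := by
  -- Continuous induction: `Q` is closed, contains `0`, and extends to the right of each of its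
  -- points in `[0, 1]`.
  let Q : Set ℝ := {t | ∃ i, g 0 ≤ q i ∧ p i * t + q i ≤ g t}
  have hQ : IsClosed Q := by
    have : Q = ⋃ i, {t | g 0 ≤ q i ∧ p i * t + q i ≤ g t} := by
      ext t
      simp [Q]
    rw [this]
    refine isClosed_iUnion_of_finite fun i => ?_
    exact isClosed_const.inter (isClosed_le (by fun_prop) hg)
  have hsub : Set.Icc (0 : ℝ) 1 ⊆ Q := by
    refine IsClosed.Icc_subset_of_forall_mem_nhdsWithin (hQ.inter isClosed_Icc) ?_ ?_
    · obtain ⟨i, hi⟩ := hsel 0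
      exact ⟨i, by simp [hi], by simp [hi]⟩
    · rintro t ⟨⟨i, hi0, hit⟩, ht⟩
      have hactive : ∀ᶠ s in nhds t, ∀ j, g t ≠ p j * t + q j → g s ≠ p j * s + q j := by
        rw [Filter.eventually_all]
        intro j
        by_cases hj : g t = p j * t + q j
        · exact Filter.Eventually.of_forall fun s h => absurd hj h
        · have hcont : Continuous fun s => p j * s + q j := by fun_prop
          filter_upwards [isOpen_ne_fun hg hcont |>.mem_nhds hj]
            with s hs _ using hs
      rcases hit.lt_or_eq with hlt | heq
      · have hcont : Continuous fun s => p i * s + q i := by fun_prop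
        filter_upwards [nhdsWithin_le_nhds
          (hcont.continuousAt.eventually_lt (hg.continuousAt (x := t)) hlt)] with s hs
        exact ⟨i, hi0, hs.le⟩
      · filter_upwards [nhdsWithin_le_nhds hactive, self_mem_nhdsWithin] with s hs hts
        obtain ⟨j, hj⟩ := hsel s
        have hjt : g t = p j * t + q j := by
          by_contra hne
          exact hs j hne hj
        rcases le_or_gt (p i * s + q i) (g s) with hle | hlt
        · exact ⟨i, hi0, hle⟩
        -- Lines `i` and `j` meet at `t` and `j` is lower at `s > t`, so `j` has the smaller slope
        -- and, as `t ≥ 0`, is at least as high at `0`.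
        · refine ⟨j, ?_, hj.ge⟩
          have hts' : t < s := hts
          have ht0 : 0 ≤ t := ht.1
          have hp : p j ≤ p i := by
            by_contra! hp
            nlinarith
          nlinarith
  obtain ⟨i, hi0, hi1⟩ := hsub (Set.right_mem_Icc.2 zero_le_one)
  exact ⟨i, hi0, by simpa using hi1⟩

/-- Restriction to the segment from `x` to `y` reduces this to one variable. -/
theorem exists_affine_ge_left_le_right {d : ℕ} {ι : Type*} [Finite ι] {f : (Fin d → ℝ) → ℝ}
    (hf : Continuous f) (l : ι → (Fin d → ℝ) → ℝ) (hl : ∀ i, l i ∈ affineFunctions d)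
    (hsel : ∀ x, ∃ i, f x = l i x) (x y : Fin d → ℝ) : ∃ i, f x ≤ l i x ∧ l i y ≤ f y := by
  choose w b hwb using fun i => mem_affineFunctions.1 (hl i)
  have key : ∀ i (t : ℝ), l i (x + t • (y - x)) = (w i ⬝ᵥ (y - x)) * t + l i x := by
    intro i t
    rw [hwb, hwb, dotProduct_add, dotProduct_smul, smul_eq_mul]
    ring
  obtain ⟨i, hi0, hi1⟩ := exists_affine_ge_at_zero_le_at_one
    (g := fun t : ℝ => f (x + t • (y - x))) (by fun_prop) (fun i => w i ⬝ᵥ (y - x))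
    (fun i => l i x) fun t => by
      obtain ⟨i, hi⟩ := hsel (x + t • (y - x))
      exact ⟨i, by rw [hi, key]⟩
  refine ⟨i, by simpa using hi0, ?_⟩
  have := key i 1
  simp only [one_smul, add_sub_cancel, mul_one] at this hi1
  rwa [this]

/-- A continuous function that agrees at each point with one of finitely many affine functions is
a difference of maxima of affine functions. -/
theorem mem_diffMaxAffine_of_continuous_selection {d : ℕ} {ι : Type*} [Fintype ι]
    {f : (Fin d → ℝ) → ℝ} (hf : Continuous f) (l : ι → (Fin d → ℝ) → ℝ)
    (hl : ∀ i, l i ∈ affineFunctions d) (hsel : ∀ x, ∃ i, f x = l i x) :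
    f ∈ diffMaxAffine d := by
  classical
  let S : (Fin d → ℝ) → Finset ι := fun x => Finset.univ.filter fun i => f x ≤ l i x
  have hS : ∀ x, (S x).Nonempty := fun x => by
    obtain ⟨i, hi⟩ := hsel x
    exact ⟨i, by simp [S, hi]⟩
  -- The default `0` is never used: only the nonempty sets `S x` occur.
  let m : Finset ι → (Fin d → ℝ) → ℝ := fun T => if h : T.Nonempty then T.inf' h l else 0
  have hm : ∀ x, m (S x) = (S x).inf' (hS x) l := fun x => dif_pos (hS x)
  let A : Finset (Finset ι) := Finset.univ.filter fun T => ∃ x, T = S x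
  have hA : A.Nonempty := ⟨S 0, by simp [A]⟩
  -- The set `S y` gives `≤` at `y`; for `≥`, each `S x` contains a piece that is below `f` at `y`.
  have hfA : f = A.sup' hA m := by
    ext y
    rw [Finset.sup'_apply]
    apply le_antisymm
    · refine le_trans ?_ (Finset.le_sup' (fun T => m T y) (show S y ∈ A by simp [A]))
      simp only [hm, Finset.inf'_apply]
      exact Finset.le_inf' _ _ fun i hi => (Finset.mem_filter.1 hi).2
    · refine Finset.sup'_le _ _ fun T hT => ?_
      obtain ⟨x, rfl⟩ := (Finset.mem_filter.1 hT).2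
      obtain ⟨i, hix, hiy⟩ := exists_affine_ge_left_le_right hf l hl hsel x y
      rw [hm, Finset.inf'_apply]
      exact (Finset.inf'_le (fun i => l i y)
        (Finset.mem_filter.2 ⟨Finset.mem_univ i, hix⟩)).trans hiy
  rw [hfA]
  refine Finset.sup'_induction hA m (p := (· ∈ diffMaxAffine d))
    (fun _ h₁ _ h₂ => sup_mem_diffMaxAffine h₁ h₂) fun T hT => ?_
  obtain ⟨x, rfl⟩ := (Finset.mem_filter.1 hT).2
  rw [hm]
  exact Finset.inf'_induction (hS x) l (p := (· ∈ diffMaxAffine d))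
    (fun _ h₁ _ h₂ => inf_mem_diffMaxAffine h₁ h₂)
    fun i _ => mem_diffMaxAffine_of_mem_affineFunctions (hl i)

/-! ### Piecewise linear functions -/

theorem IsPolyhedron.isClosed {d : ℕ} {P : Set (Fin d → ℝ)} (hP : IsPolyhedron P) :
    IsClosed P := by
  obtain ⟨m, A, c, rfl⟩ := hP
  rw [Set.ofPred_forall]
  refine isClosed_iInter fun i => isClosed_le ?_ continuous_const
  exact (continuous_apply i).comp (Continuous.matrix_mulVec continuous_const continuous_id)

theorem IsPiecewiseLinear.continuous {d e : ℕ} {f : (Fin d → ℝ) → (Fin e → ℝ)}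
    (hf : IsPiecewiseLinear f) : Continuous f := by
  obtain ⟨S, hfin, hpoly, hcov, haff⟩ := hf
  have := hfin.to_subtype
  refine (locallyFinite_of_finite fun P : S => P.1).continuous ?_
    (fun P => (hpoly P P.2).isClosed) fun P => ?_
  · rwa [← Set.sUnion_eq_iUnion]
  · obtain ⟨A, b, hAb⟩ := haff P P.2
    refine ContinuousOn.congr (Continuous.continuousOn ?_) hAb
    exact (Continuous.matrix_mulVec continuous_const continuous_id).add continuous_const

/-- The components of a piecewise linear function on `ℝ^d` are linear combinations of maxima of at
most `d + 1` affine functions. -/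
theorem IsPiecewiseLinear.component_mem_span {d e : ℕ} {f : (Fin d → ℝ) → (Fin e → ℝ)}
    (hf : IsPiecewiseLinear f) (j : Fin e) :
    (fun x => f x j) ∈ Submodule.span ℝ (affineMaxima d (d + 1)) := by
  have hcont := hf.continuous
  obtain ⟨S, hfin, -, hcov, haff⟩ := hf
  have := hfin.fintype
  choose A b hAb using fun P : S => haff P P.2
  refine mem_span_affineMaxima_of_mem_diffMaxAffine (mem_diffMaxAffine_of_continuous_selection
    ((continuous_apply j).comp hcont) (fun (P : S) x => (A P *ᵥ x + b P) j)
    (fun P => ⟨A P j, b P j, fun x => rfl⟩) fun x => ?_)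
  obtain ⟨P, hP, hx⟩ := Set.mem_sUnion.1 (hcov ▸ Set.mem_univ x)
  exact ⟨⟨P, hP⟩, congrFun (hAb ⟨P, hP⟩ x hx) j⟩

/-! ### Functions computed with `k` hidden layers -/

/-- Two neurons carry a value unchanged through a layer, since `1 + a ≠ 0`. -/
theorem sigmaA_sub_sigmaA_neg (a x : ℝ) : sigmaA a x - sigmaA a (-x) = (1 + a) * x := by
  unfold sigmaA
  split_ifs with h₁ h₂ h₂
  · obtain rfl : x = 0 := by linarith
    simp
  · ring
  · ring
  · linarith

/-- Two neurons recover the ReLU, since `1 - a ^ 2 ≠ 0`. -/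
theorem sigmaA_add_mul_sigmaA_neg (a x : ℝ) :
    sigmaA a x + a * sigmaA a (-x) = (1 - a ^ 2) * max x 0 := by
  unfold sigmaA
  split_ifs with h₁ h₂ h₂
  · obtain rfl : x = 0 := by linarith
    simp
  · rw [max_eq_left h₁]
    ring
  · rw [max_eq_right (not_le.1 h₁).le]
    ring
  · linarith

/-- The real functions on `ℝ^d` obtained from affine functions by `k` times passing to linear
combinations of their compositions with `σ_a`. -/
noncomputable def layerSpace (a : ℝ) (d : ℕ) : ℕ → Submodule ℝ ((Fin d → ℝ) → ℝ)
  | 0 => affineFunctions d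
  | k + 1 => Submodule.span ℝ ((fun (f : (Fin d → ℝ) → ℝ) (x : Fin d → ℝ) => sigmaA a (f x)) ''
       (layerSpace a d k : Set _))

theorem sigmaA_comp_mem_layerSpace {a : ℝ} {d k : ℕ} {f : (Fin d → ℝ) → ℝ}
    (hf : f ∈ layerSpace a d k) : (fun x => sigmaA a (f x)) ∈ layerSpace a d (k + 1) :=
  Submodule.subset_span ⟨f, hf, rfl⟩

theorem layerSpace_le_succ {a : ℝ} (ha : a ∈ Set.Ioo (-1 : ℝ) 1) (d k : ℕ) :
    layerSpace a d k ≤ layerSpace a d (k + 1) := by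
  intro f hf
  have h : (1 + a) • f ∈ layerSpace a d (k + 1) := by
    convert sub_mem (sigmaA_comp_mem_layerSpace hf) (sigmaA_comp_mem_layerSpace (neg_mem hf))
      using 1
    ext x
    exact (sigmaA_sub_sigmaA_neg a (f x)).symm
  exact (Submodule.smul_mem_iff _ (by linarith [ha.1])).1 h

theorem layerSpace_mono {a : ℝ} (ha : a ∈ Set.Ioo (-1 : ℝ) 1) (d : ℕ) :
    Monotone (layerSpace a d) :=
  monotone_nat_of_le_succ (layerSpace_le_succ ha d)

theorem sup_mem_layerSpace_succ {a : ℝ} (ha : a ∈ Set.Ioo (-1 : ℝ) 1) {d k : ℕ}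
    {f g : (Fin d → ℝ) → ℝ} (hf : f ∈ layerSpace a d k) (hg : g ∈ layerSpace a d k) :
    f ⊔ g ∈ layerSpace a d (k + 1) := by
  have hsub := sub_mem hf hg
  have h : (1 - a ^ 2) • (f ⊔ g - g) ∈ layerSpace a d (k + 1) := by
    convert add_mem (sigmaA_comp_mem_layerSpace hsub)
      (Submodule.smul_mem _ a (sigmaA_comp_mem_layerSpace (neg_mem hsub))) using 1
    ext x
    have := sigmaA_add_mul_sigmaA_neg a (f x - g x)
    simp only [Pi.smul_apply, Pi.sub_apply, Pi.sup_apply, Pi.add_apply, Pi.neg_apply, smul_eq_mul]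
    rw [this, ← max_sub_sub_right, sub_self]
  have h1 : (1 - a ^ 2) ≠ 0 := by nlinarith [ha.1, ha.2]
  have := add_mem ((Submodule.smul_mem_iff _ h1).1 h) (layerSpace_le_succ ha d k hg)
  rwa [sub_add_cancel] at this

theorem sup'_mem_layerSpace {a : ℝ} (ha : a ∈ Set.Ioo (-1 : ℝ) 1) {d k : ℕ}
    (s : Finset ((Fin d → ℝ) → ℝ)) (hne : s.Nonempty) (hs : ∀ f ∈ s, f ∈ affineFunctions d)
    (hcard : s.card ≤ 2 ^ k) : s.sup' hne id ∈ layerSpace a d k := by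
  classical
  induction k generalizing s with
  | zero =>
    obtain ⟨f, rfl⟩ := Finset.card_eq_one.1
      (le_antisymm (by simpa using hcard) hne.card_pos)
    simpa [layerSpace] using hs
  | succ k ih =>
    by_cases hk : s.card ≤ 2 ^ k
    · exact layerSpace_le_succ ha d k (ih s hne hs hk)
    -- Split `s` into two nonempty parts of size at most `2 ^ k` and take the maximum of their
    -- maxima.
    · obtain ⟨t, hts, htc⟩ := Finset.exists_subset_card_eq (not_le.1 hk).le
      have ht : t.Nonempty := Finset.card_pos.1 (htc ▸ by positivity)
      have hc : (s \ t).card = s.card - 2 ^ k := by rw [Finset.card_sdiff_of_subset hts, htc]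
      have hu : (s \ t).Nonempty := Finset.card_pos.1 (by omega)
      have hsup := sup_mem_layerSpace_succ ha
        (ih t ht (fun f hf => hs f (hts hf)) htc.le)
        (ih (s \ t) hu (fun f hf => hs f (Finset.sdiff_subset hf)) (by rw [pow_succ] at hcard; omega))
      rw [← Finset.sup'_union ht hu] at hsup
      simpa only [Finset.union_sdiff_of_subset hts] using hsup

theorem span_affineMaxima_le_layerSpace {a : ℝ} (ha : a ∈ Set.Ioo (-1 : ℝ) 1) {d n k : ℕ}
    (hn : n ≤ 2 ^ k) : Submodule.span ℝ (affineMaxima d n) ≤ layerSpace a d k := by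
  rw [Submodule.span_le]
  rintro _ ⟨s, hne, hs, hcard, rfl⟩
  exact sup'_mem_layerSpace ha s hne hs (hcard.trans hn)

/-! ### Networks -/

/-- Append an affine layer: the former output layer becomes the last hidden layer. -/
def NetParams.append {d m e : ℕ} {ns : List ℕ} (V : Matrix (Fin e) (Fin m) ℝ) (c : Fin e → ℝ) :
    NetParams d ns m → NetParams d (ns ++ [m]) e
  | .output W b => .hidden W b (.output V c)
  | .hidden W b rest => .hidden W b (rest.append V c)

theorem NetParams.toFun_append (σ : ℝ → ℝ) {d m e : ℕ} {ns : List ℕ}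
    (V : Matrix (Fin e) (Fin m) ℝ) (c : Fin e → ℝ) (W : NetParams d ns m) (x : Fin d → ℝ) :
    (W.append V c).toFun σ x = V *ᵥ (fun i => σ (W.toFun σ x i)) + c := by
  induction W with
  | output W b => rfl
  | hidden W b rest ih => exact ih V _

/-- A finite family in the span of `S` is given by a matrix applied to a nonempty finite family of
elements of `S`. -/
theorem exists_matrix_of_forall_mem_span {M : Type*} [AddCommGroup M] [Module ℝ M] {S : Set M}
    (hS : S.Nonempty) {e : ℕ} (f : Fin e → M) (hf : ∀ j, f j ∈ Submodule.span ℝ S) :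
    ∃ (m : ℕ) (g : Fin m → M) (V : Matrix (Fin e) (Fin m) ℝ), 0 < m ∧ (∀ i, g i ∈ S) ∧
      ∀ j, f j = ∑ i, V j i • g i := by
  classical
  choose T hTS hfT using fun j => Submodule.mem_span_finite_of_mem_span (hf j)
  obtain ⟨u, hu⟩ := hS
  -- Inserting `u` keeps the width positive even if every `T j` is empty.
  let U : Finset M := insert u (Finset.univ.biUnion T)
  have hU : ∀ v ∈ U, v ∈ S := by
    intro v hv
    rcases Finset.mem_insert.1 hv with rfl | hv
    · exact hu
    · obtain ⟨j, -, hj⟩ := Finset.mem_biUnion.1 hv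
      exact hTS j hj
  let g : Fin U.card → M := fun i => (U.equivFin.symm i : M)
  have hg : Set.range g = U := by
    ext v
    constructor
    · rintro ⟨i, rfl⟩
      exact (U.equivFin.symm i).2
    · intro hv
      exact ⟨U.equivFin ⟨v, hv⟩, by simp [g]⟩
  have hfg : ∀ j, ∃ c : Fin U.card → ℝ, ∑ i, c i • g i = f j := by
    intro j
    rw [← Submodule.mem_span_range_iff_exists_fun, hg]
    refine Submodule.span_mono (fun v hv => ?_) (hfT j)
    exact Finset.mem_insert_of_mem (Finset.mem_biUnion.2 ⟨j, Finset.mem_univ j, hv⟩)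
  choose V hV using hfg
  exact ⟨U.card, g, V, Finset.card_pos.2 (Finset.insert_nonempty _ _),
    fun i => hU _ (U.equivFin.symm i).2, fun j => (hV j).symm⟩

/-- All components share one network: the pre-activations of the last hidden layer form a single
vector-valued function one level lower, hence the induction over all `e`. -/
theorem exists_netParams_of_mem_layerSpace (a : ℝ) {d k e : ℕ} (f : (Fin d → ℝ) → (Fin e → ℝ))
    (hf : ∀ j, (fun x => f x j) ∈ layerSpace a d k) :
    ∃ ns : List ℕ, ns.length = k ∧ (∀ m ∈ ns, 0 < m) ∧
      ∃ W : NetParams d ns e, W.toFun (sigmaA a) = f := by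
  induction k generalizing e with
  | zero =>
    choose w b hwb using fun j => (mem_affineFunctions (f := fun x => f x j)).1 (hf j)
    refine ⟨[], rfl, by simp, .output (Matrix.of w) b, ?_⟩
    ext x j
    exact (hwb j x).symm
  | succ k ih =>
    obtain ⟨m, g, V, hm, hg, hV⟩ := exists_matrix_of_forall_mem_span
      (Set.Nonempty.image _ ⟨0, zero_mem (layerSpace a d k)⟩) (fun j x => f x j) hf
    choose h hh hhg using hg
    obtain ⟨ns, hlen, hpos, W, hW⟩ := ih (fun x i => h i x) hh
    -- The output bias is `0` because a positive level is a pure span of neurons, without constant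
    -- terms.
    refine ⟨ns ++ [m], by simp [hlen], ?_, W.append V 0, ?_⟩
    · intro n hn
      rcases List.mem_append.1 hn with hn | hn
      · exact hpos n hn
      · rwa [List.mem_singleton.1 hn]
    · ext x j
      rw [NetParams.toFun_append, hW, add_zero]
      have := congrFun (hV j) x
      rw [Finset.sum_apply] at this
      rw [this, Matrix.mulVec, dotProduct]
      refine Finset.sum_congr rfl fun i _ => ?_
      rw [← hhg i]
      rfl

theorem le_two_pow_ceil_logb (d : ℕ) : d + 1 ≤ 2 ^ ⌈Real.logb 2 ((d : ℝ) + 1)⌉₊ := by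
  have h : Real.logb 2 ((d : ℝ) + 1) ≤ (⌈Real.logb 2 ((d : ℝ) + 1)⌉₊ : ℝ) := Nat.le_ceil _
  rw [Real.logb_le_iff_le_rpow one_lt_two (by positivity), Real.rpow_natCast] at h
  exact_mod_cast h

theorem mainTheorem9 (a : ℝ) (ha : a ∈ Set.Ioo (-1 : ℝ) 1) (d_in d_out L : ℕ)
    (hL : ⌈Real.logb 2 ((d_in : ℝ) + 1)⌉₊ + 1 ≤ L)
    (f : (Fin d_in → ℝ) → (Fin d_out → ℝ)) (hf : IsPiecewiseLinear f) :
    ∃ ns : List ℕ, ns.length + 1 = L ∧ (∀ m ∈ ns, 0 < m) ∧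
      ∃ W : NetParams d_in ns d_out, W.toFun (sigmaA a) = f := by
  obtain ⟨k, rfl⟩ : ∃ k, L = k + 1 := ⟨L - 1, by omega⟩
  obtain ⟨ns, hlen, h⟩ := exists_netParams_of_mem_layerSpace a (k := k) f fun j =>
    layerSpace_mono ha d_in (by omega)
      (span_affineMaxima_le_layerSpace ha (le_two_pow_ceil_logb d_in) (hf.component_mem_span j))
  exact ⟨ns, by rw [hlen], h⟩
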